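/- Let $S=\{s_1,\dots,s_n\}$ be a set of $n$ nondegenerate closed line segments in the Euclidean plane, and for $H\subset S$ let $$V(H,S)=\{x\in\mathbb{R}^2 : d(x,s)<d(x,t)\ \text{for all } s\in H,\ t\in S\setminus H\},$$ where $d(x,s)=\min_{q\in s}\|x-q\|_2$. If $|H|=k$, this set is the order-$k$ Voronoi region of $H$, and its connected components are its faces. Say that $S$ is in general position if no more than three segments of $S$ touch the same circle (a segment touches a circle if it meets the circle but not the open disk bounded by it) and no more than two endpoints of segments of $S$ lie on the same line. **Lemma.** There is an absolute constant $c>0$ such that for all integers $n,k$ with $1<k<n$ there are a set $S$ of $n$ pairwise disjoint line segments in general position and a subset $H\subset S$ with $|H|=k$ whose order-$k$ Voronoi region has at least $c\,n$ faces. More precisely, for all integers $n,k$ with $1<k<n$: 1. there are such $S$ and $H$ for which the order-$k$ Voronoi region of $H$ has at least $n-k-1$ bounded faces and at least two unbounded faces (so $\Omega(n)$ faces for $1<k<n/2$); 2. there are such $S$ and $H$ for which the order-$k$ Voronoi region of $H$ has at least $k$ unbounded faces (so $\Omega(n)$ faces for $n/2\le k\le n-1$). -/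

import Mathlib

namespace SegVoronoi

/-- The Euclidean plane. -/
abbrev Plane : Type := EuclideanSpace ℝ (Fin 2)

/-- A (nondegenerate, closed) line segment in the plane, given by its two endpoints. -/
structure LineSeg where
  p : Plane
  q : Plane
  ne : p ≠ q

/-- The point set of a line segment. -/
def LineSeg.carrier (s : LineSeg) : Set Plane := segment ℝ s.p s.q

/-- The Euclidean distance from a point to a segment. The segment is nonempty and compact, so
the infimum is a minimum. -/
noncomputable def LineSeg.dist (x : Plane) (s : LineSeg) : ℝ := Metric.infDist x s.carrier

/-- The sites are pairwise disjoint (in particular pairwise distinct). -/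
def PairwiseDisjoint {n : ℕ} (S : Fin n → LineSeg) : Prop :=
  ∀ i j, i ≠ j → Disjoint (S i).carrier (S j).carrier

/-- The set of all endpoints of the sites. -/
def endpoints {n : ℕ} (S : Fin n → LineSeg) : Set Plane :=
  {e | ∃ i, e = (S i).p ∨ e = (S i).q}

/-- The segment `s` touches the circle with centre `c` and radius `r`: it meets the circle but
not the open disk that the circle bounds. -/
def Touches (s : LineSeg) (c : Plane) (r : ℝ) : Prop :=
  (s.carrier ∩ Metric.sphere c r).Nonempty ∧ Disjoint s.carrier (Metric.ball c r)

/-- General position: no more than three sites touch the same circle, and no more than two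
endpoints lie on the same line. -/
def GeneralPosition {n : ℕ} (S : Fin n → LineSeg) : Prop :=
  (∀ (c : Plane) (r : ℝ), 0 < r → {i | Touches (S i) c r}.ncard ≤ 3) ∧
  (∀ a ∈ endpoints S, ∀ b ∈ endpoints S, ∀ c ∈ endpoints S,
    a ≠ b → a ≠ c → b ≠ c → ¬ Collinear ℝ {a, b, c})

/-- The generalized Voronoi region `V(H,S)`: the points closer to every site of `H` than to any
site not in `H`. It is the order-`k` region of `H` when `H` has `k` elements. -/
def region {n : ℕ} (S : Fin n → LineSeg) (H : Finset (Fin n)) : Set Plane :=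
  {x | ∀ i ∈ H, ∀ j ∉ H, LineSeg.dist x (S i) < LineSeg.dist x (S j)}

/-- The faces of a region: its connected components (regions are open). -/
def faces (V : Set Plane) : Set (Set Plane) :=
  {F | ∃ x ∈ V, F = connectedComponentIn V x}

/-- The bounded faces of a region. -/
def boundedFaces (V : Set Plane) : Set (Set Plane) :=
  {F ∈ faces V | Bornology.IsBounded F}

/-- The unbounded faces of a region. -/
def unboundedFaces (V : Set Plane) : Set (Set Plane) :=
  {F ∈ faces V | ¬ Bornology.IsBounded F}

end SegVoronoi

open Topology Filter Module

namespace SegVoronoi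

/-! Two explicit families of segments, defined with no regard to general position, have the required
faces for reasons that survive small perturbations; a generic perturbation then provides general
position.

Perturbation (`exists_generalPosition`): four segments touching one circle satisfy four conditions
with three unknowns, and three collinear endpoints satisfy one condition. The degenerate
configurations thus form a finite union of `C¹` images of dimension at most `4 * n - 1` in a space
of dimension `4 * n`, so their complement is dense. Everything used about the two families is stated
through strict inequalities between endpoint coordinates or distances, hence holds nearby.

Two principles locate the faces. Far away in a direction, the segment with the larger support value
is nearer (`eventually_ray_dist_lt`), so a ray in a direction where every segment of `H` beats every
other segment ends in an unbounded face. If a segment outside `H` has an endpoint beyond some whole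
segment of `H` in a direction, the ray from that endpoint in that direction misses the region
(`ray_notMem_region`); such rays separate faces.

In the fan, `k` long segments of increasing slope surround tiny stubs. Each long segment blocks one
ray from a stub, and the `k` blocked rays, all with the same apex, separate `k` unbounded faces. In
the grate, `k` long horizontal rails run past `n - k` vertical stubs, one rail below them and the
others above. The vertical line through the base of each stub is blocked, so a face lies in every
strip between neighbouring stubs, and there is one unbounded face at each end. -/

/-- The endpoints of a family of segments, as a single configuration. -/
def ends {n : ℕ} (S : Fin n → LineSeg) (e : Fin n × Bool) : Plane :=
  if e.2 then (S e.1).q else (S e.1).p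

@[simp] lemma ends_false {n : ℕ} (S : Fin n → LineSeg) (i : Fin n) :
    ends S (i, false) = (S i).p := rfl

@[simp] lemma ends_true {n : ℕ} (S : Fin n → LineSeg) (i : Fin n) :
    ends S (i, true) = (S i).q := rfl

/-! ### General position by a dimension count. -/

/-- The unit vector with polar angle `θ`. -/
noncomputable def unitVec (θ : ℝ) : Plane := !₂[Real.cos θ, Real.sin θ]

/-- The unit vector with polar angle `θ`, turned by a right angle. -/
noncomputable def unitPerp (θ : ℝ) : Plane := !₂[-Real.sin θ, Real.cos θ]

/-- The endpoints of the segments touching a circle, with three parameters: either the endpoint `b₀`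
lies on the circle and the other one is free, or the segment is tangent. -/
noncomputable def touchParam (τ : Option Bool) (c : Plane) (r : ℝ) (y : ℝ × ℝ × ℝ) (b : Bool) :
    Plane :=
  match τ with
  | some b₀ => if b = b₀ then c + r • unitVec y.1 else !₂[y.2.1, y.2.2]
  | none => c + r • unitVec y.1 + (if b then y.2.2 else y.2.1) • unitPerp y.1

lemma contDiff_touchParam (τ : Option Bool) (b : Bool) :
    ContDiff ℝ 1 (fun x : (Plane × ℝ) × (ℝ × ℝ × ℝ) => touchParam τ x.1.1 x.1.2 x.2 b) := by
  have hu : ContDiff ℝ 1 unitVec := by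
    rw [contDiff_euclidean]
    intro i
    fin_cases i
    · exact Real.contDiff_cos
    · exact Real.contDiff_sin
  have hv : ContDiff ℝ 1 unitPerp := by
    rw [contDiff_euclidean]
    intro i
    fin_cases i
    · exact Real.contDiff_sin.neg
    · exact Real.contDiff_cos
  have hw : ContDiff ℝ 1 (fun x : (Plane × ℝ) × (ℝ × ℝ × ℝ) =>
      (!₂[x.2.2.1, x.2.2.2] : Plane)) := by
    rw [contDiff_euclidean]
    intro i
    fin_cases i
    · exact contDiff_snd.snd.fst
    · exact contDiff_snd.snd.snd
  rcases τ with _ | b₀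
  · cases b <;> simp only [touchParam, if_true, Bool.false_eq_true, if_false] <;> fun_prop
  · by_cases h : b = b₀ <;> simp only [touchParam, h, if_true, if_false] <;> fun_prop

lemma exists_eq_smul_unitVec (v : Plane) : ∃ θ, v = ‖v‖ • unitVec θ := by
  set z : ℂ := ⟨v 0, v 1⟩ with hz
  have hn : ‖v‖ = ‖z‖ := by
    rw [EuclideanSpace.norm_eq, Complex.norm_def, Complex.normSq_apply, Fin.sum_univ_two]
    simp [hz, sq]
  refine ⟨z.arg, ?_⟩
  ext i
  fin_cases i
  · simp [unitVec, hn, Complex.norm_mul_cos_arg, hz]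
  · simp [unitVec, hn, Complex.norm_mul_sin_arg, hz]

lemma exists_eq_smul_unitPerp {θ : ℝ} {v : Plane} (h : inner ℝ (unitVec θ) v = 0) :
    ∃ a : ℝ, v = a • unitPerp θ := by
  have h' : v 0 * Real.cos θ + v 1 * Real.sin θ = 0 := by
    simpa [unitVec, PiLp.inner_apply, Fin.sum_univ_two] using h
  have hcs := Real.sin_sq_add_cos_sq θ
  refine ⟨-(v 0) * Real.sin θ + v 1 * Real.cos θ, ?_⟩
  ext i
  fin_cases i
  · simp only [unitPerp, PiLp.smul_apply, smul_eq_mul, Fin.zero_eta, Matrix.cons_val_zero]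
    linear_combination (Real.cos θ) * h' - v 0 * hcs
  · simp only [unitPerp, PiLp.smul_apply, smul_eq_mul, Fin.mk_one, Matrix.cons_val_one,
      Matrix.cons_val_zero]
    linear_combination (Real.sin θ) * h' - v 1 * hcs

/-- The contact point `w` is the point of the segment nearest to the centre, so by convexity both
endpoints make a nonacute angle with the centre at `w`. If `w` is interior, the two nonpositive
inner products have a positive combination equal to zero, so both vanish and the segment is tangent;
otherwise `w` is an endpoint. -/
lemma Touches.exists_touchParam {s : LineSeg} {c : Plane} {r : ℝ} (hr : 0 < r)
    (h : Touches s c r) :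
    ∃ τ y, s.p = touchParam τ c r y false ∧ s.q = touchParam τ c r y true := by
  obtain ⟨⟨w, hw, hwc⟩, hd⟩ := h
  have hnorm : ‖w - c‖ = r := by simpa [dist_eq_norm] using hwc
  obtain ⟨θ, hθ⟩ := exists_eq_smul_unitVec (w - c)
  rw [hnorm] at hθ
  have hwθ : w = c + r • unitVec θ := by rw [← hθ]; abel
  have key : ∀ v ∈ s.carrier, inner ℝ (c - w) (v - w) ≤ 0 := by
    have : Nonempty (segment ℝ s.p s.q) := ⟨⟨w, hw⟩⟩
    refine (norm_eq_iInf_iff_real_inner_le_zero (convex_segment _ _) hw).1 ?_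
    refine le_antisymm (le_ciInf fun v => ?_) (ciInf_le ⟨0, ?_⟩ (⟨w, hw⟩ : segment ℝ s.p s.q))
    · by_contra hlt
      refine Set.disjoint_left.1 hd v.2 ?_
      rw [Metric.mem_ball, dist_eq_norm, norm_sub_rev]
      rw [norm_sub_rev c w, hnorm] at hlt
      exact not_le.1 hlt
    · rintro _ ⟨v, rfl⟩
      exact norm_nonneg _
  have hp := key s.p (left_mem_segment ℝ _ _)
  have hq := key s.q (right_mem_segment ℝ _ _)
  obtain ⟨a, b, ha, hb, hab, hcomb⟩ := hw
  have hlin : a • (s.p - w) + b • (s.q - w) = 0 := by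
    rw [smul_sub, smul_sub, sub_add_sub_comm, hcomb, ← add_smul, hab, one_smul, sub_self]
  rcases ha.eq_or_lt with rfl | ha
  · have : s.q = w := by
      rw [zero_add] at hab
      simpa [hab] using hcomb
    exact ⟨some true, (θ, s.p 0, s.p 1), by ext i; fin_cases i <;> simp [touchParam],
      by simp [touchParam, this, hwθ]⟩
  rcases hb.eq_or_lt with rfl | hb
  · have : s.p = w := by
      rw [add_zero] at hab
      simpa [hab] using hcomb
    exact ⟨some false, (θ, s.q 0, s.q 1), by simp [touchParam, this, hwθ],
      by ext i; fin_cases i <;> simp [touchParam]⟩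
  have hsum : a * inner ℝ (c - w) (s.p - w) + b * inner ℝ (c - w) (s.q - w) = 0 := by
    rw [← inner_smul_right, ← inner_smul_right, ← inner_add_right, hlin, inner_zero_right]
  have hp0 : inner ℝ (c - w) (s.p - w) = 0 := by nlinarith
  have hq0 : inner ℝ (c - w) (s.q - w) = 0 := by nlinarith
  have hcw : c - w = (-r) • unitVec θ := by rw [neg_smul, ← hθ]; abel
  have conv : ∀ v : Plane, inner ℝ (c - w) v = 0 → inner ℝ (unitVec θ) v = 0 := by
    intro v hv
    rw [hcw, inner_smul_left] at hv
    simpa [hr.ne'] using hv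
  obtain ⟨x, hx⟩ := exists_eq_smul_unitPerp (conv _ hp0)
  obtain ⟨y, hy⟩ := exists_eq_smul_unitPerp (conv _ hq0)
  refine ⟨none, (θ, x, y), ?_, ?_⟩
  · simp [touchParam, ← hx, ← hwθ]
  · simp [touchParam, ← hy, ← hwθ]

/-- The configurations in which the segments with index in `I` touch a common circle. -/
noncomputable def touchConfig {n : ℕ} (I : Finset (Fin n)) (τ : Fin n → Option Bool)
    (x : (Plane × ℝ) × (Fin n → ℝ × ℝ × ℝ) × ({i // i ∉ I} → ℝ)) (e : Fin n × Bool) : Plane :=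
  if h : e.1 ∈ I then touchParam (τ e.1) x.1.1 x.1.2 (x.2.1 e.1) e.2
  else if e.2 then !₂[(x.2.1 e.1).1, (x.2.1 e.1).2.1] else !₂[(x.2.1 e.1).2.2, x.2.2 ⟨e.1, h⟩]

lemma contDiff_touchConfig {n : ℕ} (I : Finset (Fin n)) (τ : Fin n → Option Bool) :
    ContDiff ℝ 1 (touchConfig I τ) := by
  rw [contDiff_pi]
  rintro ⟨i, b⟩
  by_cases h : i ∈ I
  · simp only [touchConfig, h, dif_pos]
    exact (contDiff_touchParam (τ i) b).comp
      (g := fun x : (Plane × ℝ) × (ℝ × ℝ × ℝ) => touchParam (τ i) x.1.1 x.1.2 x.2 b)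
      (f := fun x : (Plane × ℝ) × (Fin n → ℝ × ℝ × ℝ) × ({i // i ∉ I} → ℝ) => (x.1, x.2.1 i))
      (by fun_prop)
  · simp only [touchConfig, h, dif_neg, not_false_eq_true]
    rw [contDiff_euclidean]
    intro j
    cases b <;> fin_cases j <;>
      simp only [Bool.false_eq_true, if_true, if_false, Fin.zero_eta, Fin.mk_one,
        Matrix.cons_val_zero, Matrix.cons_val_one] <;> fun_prop

/-- The configurations in which the endpoint `e` lies on the line through the endpoints `a`, `b`. -/
noncomputable def collinearConfig {n : ℕ} (e : Fin n × Bool) (a b : {j // j ≠ e})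
    (x : ({j // j ≠ e} → Plane) × ℝ) (j : Fin n × Bool) : Plane :=
  if h : j = e then x.1 a + x.2 • (x.1 b - x.1 a) else x.1 ⟨j, h⟩

lemma contDiff_collinearConfig {n : ℕ} (e : Fin n × Bool) (a b : {j // j ≠ e}) :
    ContDiff ℝ 1 (collinearConfig e a b) := by
  rw [contDiff_pi]
  intro j
  by_cases h : j = e <;> simp only [collinearConfig, h, dif_pos, dif_neg, not_false_eq_true] <;>
    fun_prop

lemma finrank_config (n : ℕ) : finrank ℝ (Fin n × Bool → Plane) = 4 * n := by
  rw [finrank_pi_fintype]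
  simp
  ring

/-- The circle has 3 parameters, each of the 4 touching segments has 3, and each remaining segment
has 4: in all `3 + 3 * n + (n - 4) = 4 * n - 1`. -/
lemma dimH_range_touchConfig_le {n : ℕ} {I : Finset (Fin n)} (hI : I.card = 4)
    (τ : Fin n → Option Bool) :
    dimH (Set.range (touchConfig I τ)) ≤ ((4 * n - 1 : ℕ) : ENNReal) := by
  refine (contDiff_touchConfig I τ).dimH_range_le.trans ?_
  have h4 : 4 ≤ n := by simpa [hI] using I.card_le_univ
  have hc : Fintype.card {i // i ∉ I} = n - 4 := by
    rw [Fintype.card_subtype_compl]; simp [hI]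
  rw [Nat.cast_le, finrank_prod, finrank_prod, finrank_prod, finrank_pi_fintype,
    finrank_pi_fintype]
  simp [hc]
  omega

/-- One endpoint loses its two coordinates and gains a single position on a line: `2 * (2 * n - 1) +
1 = 4 * n - 1`. -/
lemma dimH_range_collinearConfig_le {n : ℕ} (e : Fin n × Bool) (a b : {j // j ≠ e}) :
    dimH (Set.range (collinearConfig e a b)) ≤ ((4 * n - 1 : ℕ) : ENNReal) := by
  refine (contDiff_collinearConfig e a b).dimH_range_le.trans ?_
  have hn : 0 < n := e.1.pos
  have hc : Fintype.card {j // j ≠ e} = n * 2 - 1 := by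
    rw [Fintype.card_subtype_compl]; simp
  rw [Nat.cast_le, finrank_prod, finrank_pi_fintype]
  simp only [finrank_euclideanSpace, Fintype.card_fin, Finset.sum_const, Finset.card_univ, hc,
    smul_eq_mul, finrank_self]
  omega

/-- The configurations that fail to be in general position. -/
def degenerate (n : ℕ) : Set (Fin n × Bool → Plane) :=
  (⋃ (I : {I : Finset (Fin n) // I.card = 4}) (τ : Fin n → Option Bool),
    Set.range (touchConfig I.1 τ)) ∪
  ⋃ (e : Fin n × Bool) (a : {j // j ≠ e}) (b : {j // j ≠ e}), Set.range (collinearConfig e a b)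

lemma dense_compl_degenerate {n : ℕ} (hn : 0 < n) : Dense (degenerate n)ᶜ := by
  apply dense_compl_of_dimH_lt_finrank
  rw [finrank_config]
  refine lt_of_le_of_lt (b := ((4 * n - 1 : ℕ) : ENNReal)) ?_ (by rw [Nat.cast_lt]; omega)
  simp only [degenerate, dimH_union, dimH_iUnion]
  refine sup_le (iSup_le fun I => iSup_le fun τ => dimH_range_touchConfig_le I.2 τ)
    (iSup_le fun e => iSup_le fun a => iSup_le fun b => dimH_range_collinearConfig_le e a b)

lemma exists_ends_eq {n : ℕ} {S : Fin n → LineSeg} {a : Plane} (h : a ∈ endpoints S) :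
    ∃ e, ends S e = a := by
  obtain ⟨i, rfl | rfl⟩ := h
  · exact ⟨(i, false), rfl⟩
  · exact ⟨(i, true), rfl⟩

theorem generalPosition_of_notMem_degenerate {n : ℕ} {S : Fin n → LineSeg}
    (h : ends S ∉ degenerate n) : GeneralPosition S := by
  constructor
  · intro c r hr
    by_contra! hlt
    obtain ⟨I, hIs, hI⟩ := Finset.exists_subset_card_eq (s := (Set.toFinite
      {i | Touches (S i) c r}).toFinset) (n := 4)
      (by rw [← Set.ncard_eq_toFinset_card]; exact hlt)
    have hIt : ∀ i ∈ I, Touches (S i) c r := fun i hi => by simpa using hIs hi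
    have : ∀ i, ∃ τ y, i ∈ I →
        (S i).p = touchParam τ c r y false ∧ (S i).q = touchParam τ c r y true := by
      intro i
      by_cases hi : i ∈ I
      · obtain ⟨τ, y, hy⟩ := (hIt i hi).exists_touchParam hr
        exact ⟨τ, y, fun _ => hy⟩
      · exact ⟨none, 0, fun h => absurd h hi⟩
    choose τ y hy using this
    -- For a segment outside `I`, three of its endpoint coordinates fill its triple, and the fourth
    -- goes into the last factor.
    refine h (Or.inl (Set.mem_iUnion₂.2 ⟨⟨I, hI⟩, τ, ((c, r),
      (fun i => if i ∈ I then y i else ((S i).q 0, (S i).q 1, (S i).p 0)),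
      fun i => (S i.1).p 1), ?_⟩))
    funext ⟨i, b⟩
    by_cases hi : i ∈ I
    · cases b
      · simp [touchConfig, hi, (hy i hi).1]
      · simp [touchConfig, hi, (hy i hi).2]
    · cases b <;> ext j <;> fin_cases j <;> simp [touchConfig, hi]
  · intro a ha b hb c hc hab hac hbc hcol
    obtain ⟨a, rfl⟩ := exists_ends_eq ha
    obtain ⟨b, rfl⟩ := exists_ends_eq hb
    obtain ⟨c, rfl⟩ := exists_ends_eq hc
    rw [collinear_iff_of_mem (p₀ := ends S a) (by simp)] at hcol
    obtain ⟨v, hv⟩ := hcol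
    obtain ⟨s, hs⟩ := hv (ends S b) (by simp)
    obtain ⟨t, ht⟩ := hv (ends S c) (by simp)
    rw [vadd_eq_add] at hs ht
    have hs0 : s ≠ 0 := by
      rintro rfl
      exact hab (by simp [hs])
    have hac' : a ≠ c := fun h => hac (by rw [h])
    have hbc' : b ≠ c := fun h => hbc (by rw [h])
    refine h (Or.inr ?_)
    simp only [Set.mem_iUnion]
    -- With `b = a + s v`, `c = a + t v` and `s ≠ 0`, the point `c` has parameter `t / s` on the
    -- line from `a` to `b`.
    refine ⟨c, ⟨a, hac'⟩, ⟨b, hbc'⟩, (fun j => ends S j.1, t / s), ?_⟩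
    funext j
    by_cases hj : j = c
    · subst hj
      simp only [collinearConfig, dif_pos]
      rw [ht, hs, add_sub_cancel_right, smul_smul, div_mul_cancel₀ _ hs0, add_comm]
    · simp [collinearConfig, hj]

/-- The difference of the points with parameters `(s, t)` vanishes nowhere on the compact unit
square at `x₀`, hence nowhere on it for nearby `x`. -/
lemma eventually_disjoint_segment {α : Type*} [TopologicalSpace α] {x₀ : α} {p q p' q' : α → Plane}
    (hp : Continuous p) (hq : Continuous q) (hp' : Continuous p') (hq' : Continuous q')
    (h : Disjoint (segment ℝ (p x₀) (q x₀)) (segment ℝ (p' x₀) (q' x₀))) :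
    ∀ᶠ x in 𝓝 x₀, Disjoint (segment ℝ (p x) (q x)) (segment ℝ (p' x) (q' x)) := by
  have key : ∀ᶠ x in 𝓝 x₀, ∀ t ∈ Set.Icc (0 : ℝ) 1 ×ˢ Set.Icc (0 : ℝ) 1,
      AffineMap.lineMap (p x) (q x) t.1 - (AffineMap.lineMap (p' x) (q' x) t.2 : Plane) ≠ 0 := by
    refine (isCompact_Icc.prod isCompact_Icc).eventually_forall_of_forall_eventually ?_
    rintro ⟨s, t⟩ ⟨hs, ht⟩
    have hc : Continuous fun z : α × ℝ × ℝ => AffineMap.lineMap (p z.1) (q z.1) z.2.1 -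
        (AffineMap.lineMap (p' z.1) (q' z.1) z.2.2 : Plane) := by
      simp only [AffineMap.lineMap_apply_module]
      fun_prop
    refine hc.continuousAt.eventually_ne ?_
    rw [sub_ne_zero]
    refine h.ne_of_mem ?_ ?_ <;> rw [segment_eq_image_lineMap]
    · exact ⟨s, hs, rfl⟩
    · exact ⟨t, ht, rfl⟩
  filter_upwards [key] with x hx
  rw [segment_eq_image_lineMap, segment_eq_image_lineMap, Set.disjoint_left]
  rintro _ ⟨s, hs, rfl⟩ ⟨t, ht, hst⟩
  exact hx (s, t) ⟨hs, ht⟩ (by rw [← hst, sub_self])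

/-- Pairwise disjoint segments can be brought into general position, keeping any property
that holds for all configurations near the given one. -/
theorem exists_generalPosition {n : ℕ} (hn : 0 < n) {S : Fin n → LineSeg}
    (hS : PairwiseDisjoint S) {Q : (Fin n × Bool → Plane) → Prop} (hQ : ∀ᶠ z in 𝓝 (ends S), Q z) :
    ∃ T : Fin n → LineSeg, PairwiseDisjoint T ∧ GeneralPosition T ∧ Q (ends T) := by
  have hne : ∀ᶠ z in 𝓝 (ends S), ∀ i, z (i, false) ≠ z (i, true) := by
    refine eventually_all.2 fun i => ?_
    have hc : Continuous fun z : Fin n × Bool → Plane => z (i, false) - z (i, true) := by fun_prop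
    filter_upwards [hc.continuousAt.eventually_ne (sub_ne_zero.2 (S i).ne)] with z hz
    exact sub_ne_zero.1 hz
  have hdis : ∀ᶠ z in 𝓝 (ends S), ∀ i j, i ≠ j →
      Disjoint (segment ℝ (z (i, false)) (z (i, true)))
        (segment ℝ (z (j, false)) (z (j, true))) := by
    refine eventually_all.2 fun i => eventually_all.2 fun j => ?_
    by_cases hij : i = j
    · simp [hij]
    · exact (eventually_disjoint_segment (x₀ := ends S)
        (p := fun z => z (i, false)) (q := fun z => z (i, true))
        (p' := fun z => z (j, false)) (q' := fun z => z (j, true))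
        (by fun_prop) (by fun_prop) (by fun_prop) (by fun_prop) (hS i j hij)).mono
        fun z hz _ => hz
  obtain ⟨z, ⟨hzne, hzd, hzQ⟩, hz⟩ :=
    mem_closure_iff_nhds.1 ((dense_compl_degenerate hn) (ends S)) _ (hne.and (hdis.and hQ))
  have hends : ends (fun i => ⟨z (i, false), z (i, true), hzne i⟩) = z := by
    funext ⟨i, b⟩
    cases b <;> rfl
  refine ⟨fun i => ⟨z (i, false), z (i, true), hzne i⟩, hzd, ?_, ?_⟩
  · exact generalPosition_of_notMem_degenerate (by rwa [hends])
  · rwa [hends]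

/-! ### Distances along rays, and separation of faces. -/

lemma dist_sq_eq (x y : Plane) : dist x y ^ 2 = (x 0 - y 0) ^ 2 + (x 1 - y 1) ^ 2 := by
  rw [EuclideanSpace.dist_eq, Fin.sum_univ_two, Real.sq_sqrt (by positivity), Real.dist_eq,
    Real.dist_eq, sq_abs, sq_abs]

namespace LineSeg

lemma p_mem (s : LineSeg) : s.p ∈ s.carrier := left_mem_segment ℝ _ _

lemma q_mem (s : LineSeg) : s.q ∈ s.carrier := right_mem_segment ℝ _ _

lemma dist_le {s : LineSeg} {x y : Plane} (hy : y ∈ s.carrier) : s.dist x ≤ Dist.dist x y :=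
  Metric.infDist_le_dist_of_mem hy

lemma exists_dist_eq (s : LineSeg) (x : Plane) : ∃ y ∈ s.carrier, s.dist x = Dist.dist x y := by
  refine IsCompact.exists_infDist_eq_dist ?_ ⟨_, s.p_mem⟩ x
  rw [carrier, segment_eq_image_lineMap]
  exact isCompact_Icc.image AffineMap.lineMap_continuous

lemma lin_lt {s : LineSeg} {a b M : ℝ} (hp : a * s.p 0 + b * s.p 1 < M)
    (hq : a * s.q 0 + b * s.q 1 < M) {y : Plane} (hy : y ∈ s.carrier) :
    a * y 0 + b * y 1 < M := by
  obtain ⟨u, v, hu, hv, huv, rfl⟩ := hy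
  simp only [PiLp.add_apply, PiLp.smul_apply, smul_eq_mul]
  rcases hu.eq_or_lt with rfl | hu
  · obtain rfl : v = 1 := by linarith
    linarith
  · have h1 := mul_lt_mul_of_pos_left hp hu
    have h2 := mul_le_mul_of_nonneg_left hq.le hv
    have h3 : u * M + v * M = M := by rw [← add_mul, huv, one_mul]
    linarith

end LineSeg

/-- The point with parameter `r` on the ray from `o` in direction `(a, b)`. -/
noncomputable def ray (o : Plane) (a b r : ℝ) : Plane := !₂[o 0 + r * a, o 1 + r * b]

@[simp] lemma ray_zero (o : Plane) (a b r : ℝ) : ray o a b r 0 = o 0 + r * a := rfl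

@[simp] lemma ray_one (o : Plane) (a b r : ℝ) : ray o a b r 1 = o 1 + r * b := rfl

lemma continuous_ray (o : Plane) (a b : ℝ) : Continuous (ray o a b) := by
  refine (PiLp.continuous_toLp 2 _).comp (continuous_pi fun i => ?_)
  fin_cases i <;> simp <;> fun_prop

/-- Far away in direction `(a, b)`, the nearer segment is the one reaching farther in that
direction. -/
lemma eventually_ray_dist_lt {s t : LineSeg} {a b : ℝ} {e : Plane} (o : Plane) (he : e ∈ s.carrier)
    (hp : a * t.p 0 + b * t.p 1 < a * e 0 + b * e 1)
    (hq : a * t.q 0 + b * t.q 1 < a * e 0 + b * e 1) :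
    ∀ᶠ r in atTop, s.dist (ray o a b r) < t.dist (ray o a b r) := by
  obtain ⟨M, hM, hMe⟩ := exists_between (max_lt hp hq)
  have hδ : 0 < a * e 0 + b * e 1 - M := sub_pos.2 hMe
  -- Along the ray, the squared distance to a point `y` of `t` minus that to `e` is at least `2 * r
  -- * (⟨(a, b), e⟩ - M) - dist o e ^ 2`, positive beyond this threshold.
  filter_upwards [eventually_gt_atTop
    (dist o e ^ 2 / (2 * (a * e 0 + b * e 1 - M))), eventually_ge_atTop 0] with r hr hr0
  obtain ⟨y, hy, hty⟩ := t.exists_dist_eq (ray o a b r)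
  rw [hty]
  refine (LineSeg.dist_le he).trans_lt ?_
  have hyM : a * y 0 + b * y 1 < M :=
    LineSeg.lin_lt ((le_max_left _ _).trans_lt hM) ((le_max_right _ _).trans_lt hM) hy
  rw [div_lt_iff₀ (by positivity), dist_sq_eq] at hr
  refine (sq_lt_sq₀ dist_nonneg dist_nonneg).1 ?_
  rw [dist_sq_eq, dist_sq_eq]
  simp only [ray_zero, ray_one]
  nlinarith [mul_le_mul_of_nonneg_left hyM.le hr0, sq_nonneg (o 0 - y 0), sq_nonneg (o 1 - y 1)]

lemma eventually_ray_mem_region {n : ℕ} {S : Fin n → LineSeg} {H : Finset (Fin n)} {a b : ℝ}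
    (o : Plane)
    (h : ∀ i ∈ H, ∀ j ∉ H, ∃ c, ∀ d, a * ends S (j, d) 0 + b * ends S (j, d) 1 <
      a * ends S (i, c) 0 + b * ends S (i, c) 1) :
    ∀ᶠ r in atTop, ray o a b r ∈ region S H := by
  have : ∀ i j, ∀ᶠ r in atTop, i ∈ H → j ∉ H →
      (S i).dist (ray o a b r) < (S j).dist (ray o a b r) := by
    intro i j
    by_cases hi : i ∈ H
    · by_cases hj : j ∈ H
      · simp [hj]
      · obtain ⟨c, hc⟩ := h i hi j hj
        refine (eventually_ray_dist_lt o (e := ends S (i, c)) ?_ (hc false) (hc true)).mono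
          fun r hr _ _ => hr
        cases c
        exacts [(S i).p_mem, (S i).q_mem]
    · simp [hi]
  filter_upwards [eventually_all.2 fun i => eventually_all.2 fun j => this i j] with r hr i hi j hj
  exact hr i j hi hj

lemma not_isBounded_ray {o : Plane} {a b : ℝ} (hab : a ≠ 0 ∨ b ≠ 0) (R : ℝ) :
    ¬ Bornology.IsBounded (ray o a b '' Set.Ici R) := by
  intro h
  have key : ∀ (i : Fin 2) (u v : ℝ), v ≠ 0 → (∀ r, ray o a b r i = u + r * v) → False := by
    intro i u v hv hi
    obtain ⟨C, hC⟩ := isBounded_iff_forall_norm_le.1 h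
    have hb : ∀ r ≥ R, |u + r * v| ≤ C := fun r hr => by
      rw [← hi, ← Real.norm_eq_abs]
      exact (PiLp.norm_apply_le _ i).trans (hC _ ⟨r, hr, rfl⟩)
    set r := max R ((|u| + C + 1) / |v|)
    have h1 := hb r (le_max_left _ _)
    have h2 : (|u| + C + 1) / |v| ≤ r := le_max_right _ _
    rw [div_le_iff₀ (abs_pos.2 hv)] at h2
    have h3 : r * |v| ≤ |r * v| := by
      rw [abs_mul]
      exact mul_le_mul_of_nonneg_right (le_abs_self r) (abs_nonneg v)
    have h4 := abs_sub (u + r * v) u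
    rw [add_sub_cancel_left] at h4
    linarith
  rcases hab with ha | hb
  · exact key 0 _ a ha fun r => rfl
  · exact key 1 _ b hb fun r => rfl

lemma eventually_component_ray_mem_unboundedFaces {V : Set Plane} {o : Plane} {a b : ℝ}
    (hab : a ≠ 0 ∨ b ≠ 0) (h : ∀ᶠ r in atTop, ray o a b r ∈ V) :
    ∀ᶠ r in atTop, connectedComponentIn V (ray o a b r) ∈ unboundedFaces V := by
  obtain ⟨R, hR⟩ := eventually_atTop.1 h
  filter_upwards [eventually_ge_atTop R] with r hr
  refine ⟨⟨_, hR r hr, rfl⟩, fun hb => not_isBounded_ray (o := o) hab r (hb.subset ?_)⟩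
  refine IsPreconnected.subset_connectedComponentIn
    (isPreconnected_Ici.image _ (continuous_ray o a b).continuousOn) ⟨r, Set.self_mem_Ici, rfl⟩ ?_
  rintro _ ⟨s, hs, rfl⟩
  exact hR s (hr.trans hs)

lemma connectedComponentIn_subset_left {X : Type*} [TopologicalSpace X] {V U W : Set X} {x : X}
    (hU : IsOpen U) (hW : IsOpen W) (hUW : Disjoint U W) (hV : V ⊆ U ∪ W) (hx : x ∈ V)
    (hxU : x ∈ U) : connectedComponentIn V x ⊆ U :=
  isPreconnected_connectedComponentIn.subset_left_of_subset_union hU hW hUW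
    ((connectedComponentIn_subset V x).trans hV) ⟨x, mem_connectedComponentIn hx, hxU⟩

lemma connectedComponentIn_ne {X : Type*} [TopologicalSpace X] {V U W : Set X} {x y : X}
    (hU : IsOpen U) (hW : IsOpen W) (hUW : Disjoint U W) (hV : V ⊆ U ∪ W) (hx : x ∈ V)
    (hxU : x ∈ U) (hy : y ∈ V) (hyW : y ∈ W) :
    connectedComponentIn V x ≠ connectedComponentIn V y := fun h =>
  Set.disjoint_left.1 hUW (connectedComponentIn_subset_left hU hW hUW hV hx hxU
    (h ▸ mem_connectedComponentIn hy)) hyW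

lemma natCast_le_encard {α : Type*} {s : Set α} {m : ℕ} (f : Fin m → α)
    (hf : Function.Injective f) (hs : ∀ i, f i ∈ s) : (m : ℕ∞) ≤ s.encard := by
  calc (m : ℕ∞) = (Set.range f).encard := by
        rw [← Set.image_univ, hf.encard_image, Set.encard_univ]; simp
    _ ≤ s.encard := Set.encard_le_encard (Set.range_subset_iff.2 hs)

/-- If the point `o` of `t` lies farther in direction `(a, b)` than all of `s`, the points of the
ray from `o` in that direction are at least as near to `t` as to `s`. -/
lemma dist_ray_le {s t : LineSeg} {o : Plane} {a b r : ℝ} (hr : 0 ≤ r) (ho : o ∈ t.carrier)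
    (hp : a * s.p 0 + b * s.p 1 < a * o 0 + b * o 1)
    (hq : a * s.q 0 + b * s.q 1 < a * o 0 + b * o 1) :
    t.dist (ray o a b r) ≤ s.dist (ray o a b r) := by
  obtain ⟨y, hy, hsy⟩ := s.exists_dist_eq (ray o a b r)
  rw [hsy]
  refine (LineSeg.dist_le ho).trans ?_
  have h := LineSeg.lin_lt hp hq hy
  refine (sq_le_sq₀ dist_nonneg dist_nonneg).1 ?_
  rw [dist_sq_eq, dist_sq_eq]
  simp only [ray_zero, ray_one]
  nlinarith [mul_le_mul_of_nonneg_left h.le hr, sq_nonneg (o 0 - y 0), sq_nonneg (o 1 - y 1)]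

/-- This is how rays are blocked: along the whole ray, the segment `j` outside `H` is at least as
near as the segment `i` of `H`. -/
lemma ray_notMem_region {n : ℕ} {S : Fin n → LineSeg} {H : Finset (Fin n)} {i j : Fin n}
    (hi : i ∈ H) (hj : j ∉ H) {a b r : ℝ} (hr : 0 ≤ r)
    (h : ∀ c, a * ends S (i, c) 0 + b * ends S (i, c) 1 <
      a * ends S (j, false) 0 + b * ends S (j, false) 1) :
    ray (ends S (j, false)) a b r ∉ region S H := fun hx =>
  (hx i hi j hj).not_ge (dist_ray_le hr (S j).p_mem (h false) (h true))

lemma eventually_lin_lt {ι : Type*} [Fintype ι] {z₀ : ι → Plane} {a b : ℝ} {e e' : ι}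
    (h : a * z₀ e 0 + b * z₀ e 1 < a * z₀ e' 0 + b * z₀ e' 1) :
    ∀ᶠ z in 𝓝 z₀, a * z e 0 + b * z e 1 < a * z e' 0 + b * z e' 1 := by
  have h1 : Continuous fun z : ι → Plane => a * z e 0 + b * z e 1 := by fun_prop
  have h2 : Continuous fun z : ι → Plane => a * z e' 0 + b * z e' 1 := by fun_prop
  exact (h1.tendsto z₀).eventually_lt (h2.tendsto z₀) h

lemma pairwiseDisjoint_of_lt {n : ℕ} {S : Fin n → LineSeg}
    (h : ∀ i j, i < j → Disjoint (S i).carrier (S j).carrier) : PairwiseDisjoint S := by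
  intro i j hij
  rcases lt_or_gt_of_ne hij with hlt | hlt
  exacts [h i j hlt, (h j i hlt).symm]

lemma injective_of_lt_imp_ne {m : ℕ} {α : Type*} {f : Fin m → α} (h : ∀ i j, i < j → f i ≠ f j) :
    Function.Injective f := by
  intro i j hij
  by_contra hne
  rcases lt_or_gt_of_ne hne with hlt | hlt
  exacts [h i j hlt hij, h j i hlt hij.symm]

/-- The set of the first `k` indices. -/
def initial (n k : ℕ) : Finset (Fin n) := Finset.univ.filter fun i => i.val < k

@[simp] lemma mem_initial {n k : ℕ} {i : Fin n} : i ∈ initial n k ↔ i.val < k := by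
  simp [initial]

lemma card_initial {n k : ℕ} (hk : k < n) : (initial n k).card = k := by
  have : initial n k = Finset.Iio ⟨k, hk⟩ := by
    ext i
    simp [Fin.lt_def]
  rw [this, Fin.card_Iio]

/-! ### The fan: `k` unbounded faces. -/

/-- A short vertical segment standing on the horizontal axis. -/
noncomputable def stub (x : ℝ) : LineSeg where
  p := !₂[x, 0]
  q := !₂[x, 1 / 2]
  ne h := by simpa using congrArg (fun y : Plane => y 1) h

lemma mem_stub {x : ℝ} {y : Plane} (h : y ∈ (stub x).carrier) :
    y 0 = x ∧ 0 ≤ y 1 ∧ y 1 ≤ 1 / 2 := by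
  obtain ⟨u, v, hu, hv, huv, rfl⟩ := h
  simp only [stub, PiLp.add_apply, PiLp.smul_apply, smul_eq_mul, Matrix.cons_val_zero,
    Matrix.cons_val_one]
  refine ⟨by rw [← add_mul, huv, one_mul], by linarith, by linarith⟩

/-- The segments of a nested family spanning, seen from near the origin, almost a straight angle,
with slopes `3 * i`. -/
noncomputable def fanSeg (i : ℕ) : LineSeg where
  p := !₂[-5 ^ i, 5 ^ i * (1 - 3 * i)]
  q := !₂[5 ^ i, 5 ^ i * (1 + 3 * i)]
  ne h := by
    have h0 : (-5 ^ i : ℝ) = 5 ^ i := by simpa using congrArg (fun y : Plane => y 0) h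
    have : (0 : ℝ) < 5 ^ i := by positivity
    linarith

lemma mem_fanSeg {i : ℕ} {y : Plane} (h : y ∈ (fanSeg i).carrier) :
    -5 ^ i ≤ y 0 ∧ y 1 = 5 ^ i + 3 * i * y 0 := by
  obtain ⟨u, v, hu, hv, huv, rfl⟩ := h
  obtain rfl : u = 1 - v := by linarith
  simp only [fanSeg, PiLp.add_apply, PiLp.smul_apply, smul_eq_mul, Matrix.cons_val_zero,
    Matrix.cons_val_one]
  have : (0 : ℝ) ≤ v * 5 ^ i := by positivity
  exact ⟨by linarith, by ring⟩

lemma one_add_four_mul_le (d : ℕ) : 1 + 4 * (d : ℝ) ≤ 5 ^ d := by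
  have := one_add_mul_le_pow (R := ℝ) (a := 4) (by norm_num) d
  norm_num at this
  linarith

/-- With `d = j - i`, the supporting lines cross at abscissa `-5 ^ i * (5 ^ d - 1) / (3 * d)`. By
Bernoulli `5 ^ d - 1 ≥ 4 * d`, so the crossing lies to the left of the segment `i`. -/
lemma disjoint_fanSeg {i j : ℕ} (hij : i < j) :
    Disjoint (fanSeg i).carrier (fanSeg j).carrier := by
  rw [Set.disjoint_left]
  intro y hi hj
  obtain ⟨hy, hi⟩ := mem_fanSeg hi
  obtain ⟨-, hj⟩ := mem_fanSeg hj
  obtain ⟨d, rfl⟩ := Nat.exists_eq_add_of_lt hij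
  have h := one_add_four_mul_le (d + 1)
  have h5 : (0 : ℝ) < 5 ^ i := by positivity
  have hp : (5 : ℝ) ^ (i + d + 1) = 5 ^ i * 5 ^ (d + 1) := by rw [add_assoc, pow_add]
  rw [hp] at hj
  push_cast at hj h
  have hd : (0 : ℝ) ≤ d := Nat.cast_nonneg d
  nlinarith [mul_le_mul_of_nonneg_left h h5.le, mul_le_mul_of_nonneg_left hy hd]

lemma disjoint_fanSeg_stub (i : ℕ) {x : ℝ} (h1 : -1 ≤ x) :
    Disjoint (fanSeg i).carrier (stub x).carrier := by
  rw [Set.disjoint_left]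
  intro y hi hj
  obtain ⟨-, hi⟩ := mem_fanSeg hi
  obtain ⟨hx, -, hj⟩ := mem_stub hj
  have h := one_add_four_mul_le i
  rw [hx] at hi
  have hd : (0 : ℝ) ≤ i := Nat.cast_nonneg i
  nlinarith

lemma disjoint_stub {x x' : ℝ} (h : x ≠ x') : Disjoint (stub x).carrier (stub x').carrier := by
  rw [Set.disjoint_left]
  exact fun y hy hy' => h ((mem_stub hy).1.symm.trans (mem_stub hy').1)

/-- The family of `k` fan segments, and of `n - k` stubs near the origin. -/
noncomputable def fan (n k : ℕ) (i : Fin n) : LineSeg :=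
  if i.val < k then fanSeg i else stub (-(i.val / n))

lemma neg_one_le_neg_div (n : ℕ) (i : Fin n) : -1 ≤ -((i.val : ℝ) / n) := by
  have hn : (0 : ℝ) < n := Nat.cast_pos.2 i.pos
  rw [neg_le_neg_iff, div_le_one hn]
  exact_mod_cast i.2.le

lemma pairwiseDisjoint_fan (n k : ℕ) : PairwiseDisjoint (fan n k) := by
  refine pairwiseDisjoint_of_lt fun i j hij => ?_
  have hij' : i.val < j.val := hij
  have hn : (0 : ℝ) < n := Nat.cast_pos.2 i.pos
  by_cases hi : i.val < k <;> by_cases hj : j.val < k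
  · simpa [fan, hi, hj] using disjoint_fanSeg hij'
  · simpa [fan, hi, hj] using disjoint_fanSeg_stub i (neg_one_le_neg_div n j)
  · omega
  · have : ((i.val : ℝ) / n) ≠ j.val / n := by
      rw [Ne, div_left_inj' hn.ne', Nat.cast_inj]
      omega
    simpa [fan, hi, hj] using disjoint_stub (fun h => this (neg_injective h))

/-- The directions of the unbounded faces in the fan. -/
noncomputable def fanDir (k i : ℕ) : ℝ × ℝ := if i + 1 < k then (3 * i + 3 / 2, -1) else (0, 1)

lemma fanDir_ne (k i : ℕ) : (fanDir k i).1 ≠ 0 ∨ (fanDir k i).2 ≠ 0 := by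
  right
  unfold fanDir
  split_ifs <;> norm_num

/-- In direction `(a, -1)` the better endpoint of the fan segment `s` has value `5 ^ s * (|a - 3 *
s| - 1)`. For `a = 3 * i + 3 / 2`, halfway between two slopes, this is positive, while stubs have
nonpositive values. -/
lemma fanDir_stub_lt_fan {n k : ℕ} (i : ℕ) {s t : Fin n} (hs : s.val < k) (ht : ¬ t.val < k) :
    ∃ c, ∀ d, (fanDir k i).1 * ends (fan n k) (t, d) 0 + (fanDir k i).2 * ends (fan n k) (t, d) 1 <
      (fanDir k i).1 * ends (fan n k) (s, c) 0 + (fanDir k i).2 * ends (fan n k) (s, c) 1 := by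
  have h5 : (1 : ℝ) ≤ 5 ^ s.val := one_le_pow₀ (by norm_num)
  have hs0 : (0 : ℝ) ≤ s.val := Nat.cast_nonneg _
  have hi0 : (0 : ℝ) ≤ i := Nat.cast_nonneg _
  have ht0 : (0 : ℝ) ≤ t.val / n := by positivity
  have hti : (0 : ℝ) ≤ (3 * i + 3 / 2) * (t.val / n) := by positivity
  unfold fanDir
  split_ifs with hik
  · by_cases his : i < s.val
    · have his' : (i : ℝ) + 1 ≤ s.val := by exact_mod_cast his
      refine ⟨false, fun d => ?_⟩
      cases d <;> simp [fan, hs, ht, fanSeg, stub] <;> nlinarith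
    · have his' : (s.val : ℝ) ≤ i := by exact_mod_cast not_lt.1 his
      refine ⟨true, fun d => ?_⟩
      cases d <;> simp [fan, hs, ht, fanSeg, stub] <;> nlinarith
  · refine ⟨true, fun d => ?_⟩
    cases d <;> simp [fan, hs, ht, fanSeg, stub] <;> nlinarith

/-- The direction `(3 * i, -1)` is normal to the segment `i`, which has constant value `-5 ^ i`
there; the base of a stub has value at least `-3 * i`, which is larger. Hence the ray from the base
in this direction is blocked. -/
lemma fan_lt_stub {n k : ℕ} {i t : Fin n} (hi : i.val < k) (ht : ¬ t.val < k) (c : Bool) :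
    (3 * i.val : ℝ) * ends (fan n k) (i, c) 0 + (-1) * ends (fan n k) (i, c) 1 <
      (3 * i.val : ℝ) * ends (fan n k) (t, false) 0 + (-1) * ends (fan n k) (t, false) 1 := by
  have h5 := one_add_four_mul_le i.val
  have hi0 : (0 : ℝ) ≤ i.val := Nat.cast_nonneg _
  have h1 := neg_one_le_neg_div n t
  have h2 := mul_le_mul_of_nonneg_left h1 hi0
  cases c <;> simp [fan, hi, ht, fanSeg, stub] <;> nlinarith

lemma eventually_fan {n k : ℕ} : ∀ᶠ z in 𝓝 (ends (fan n k)),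
    (∀ i : Fin n, ∀ s ∈ initial n k, ∀ t ∉ initial n k, ∃ c, ∀ d,
      (fanDir k i).1 * z (t, d) 0 + (fanDir k i).2 * z (t, d) 1 <
        (fanDir k i).1 * z (s, c) 0 + (fanDir k i).2 * z (s, c) 1) ∧
    (∀ i ∈ initial n k, ∀ t ∉ initial n k, ∀ c,
      (3 * i.val : ℝ) * z (i, c) 0 + (-1) * z (i, c) 1 <
        (3 * i.val : ℝ) * z (t, false) 0 + (-1) * z (t, false) 1) := by
  simp only [mem_initial]
  refine .and (eventually_all.2 fun i => eventually_all.2 fun s => ?_)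
    (eventually_all.2 fun i => ?_)
  · refine eventually_imp_distrib_left.2 fun hs => eventually_all.2 fun t =>
      eventually_imp_distrib_left.2 fun ht => ?_
    obtain ⟨c, hc⟩ := fanDir_stub_lt_fan i.val hs ht
    exact (eventually_all.2 fun d => eventually_lin_lt (hc d)).mono fun z hz => ⟨c, hz⟩
  · exact eventually_imp_distrib_left.2 fun hi => eventually_all.2 fun t =>
      eventually_imp_distrib_left.2 fun ht => eventually_all.2 fun c =>
        eventually_lin_lt (fan_lt_stub hi ht c)

/-- The open sector with apex `o` between the directions `(3 * i, -1)` and `(3 * (i + 1), -1)`. -/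
def sector (o : Plane) (i : ℕ) : Set Plane :=
  {x | 0 < (x 0 - o 0) + 3 * i * (x 1 - o 1)} ∩ {x | (x 0 - o 0) + 3 * (i + 1) * (x 1 - o 1) < 0}

/-- The exterior of the sector with apex `o` between the directions `(3 * i, -1)` and
`(3 * (i + 1), -1)`. -/
def sectorExterior (o : Plane) (i : ℕ) : Set Plane :=
  {x | (x 0 - o 0) + 3 * i * (x 1 - o 1) < 0} ∪ {x | 0 < (x 0 - o 0) + 3 * (i + 1) * (x 1 - o 1)}

lemma isOpen_sector (o : Plane) (i : ℕ) : IsOpen (sector o i) :=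
  (isOpen_lt (by fun_prop) (by fun_prop)).inter (isOpen_lt (by fun_prop) (by fun_prop))

lemma isOpen_sectorExterior (o : Plane) (i : ℕ) : IsOpen (sectorExterior o i) :=
  (isOpen_lt (by fun_prop) (by fun_prop)).union (isOpen_lt (by fun_prop) (by fun_prop))

lemma disjoint_sector (o : Plane) (i : ℕ) : Disjoint (sector o i) (sectorExterior o i) := by
  rw [Set.disjoint_left]
  rintro x ⟨h1, h2⟩ (h3 | h3)
  · exact lt_asymm (Set.mem_ofPred.1 h1) (Set.mem_ofPred.1 h3)
  · exact lt_asymm (Set.mem_ofPred.1 h2) (Set.mem_ofPred.1 h3)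

/-- A point in neither open set lies on one of the two bounding lines through `o`, and the remaining
inequality places it on the half of that line going downwards, which is a blocked ray. -/
lemma subset_sector_union {V : Set Plane} {o : Plane} {i : ℕ}
    (h : ∀ r ≥ 0, ray o (3 * i) (-1) r ∉ V) (h' : ∀ r ≥ 0, ray o (3 * (i + 1)) (-1) r ∉ V) :
    V ⊆ sector o i ∪ sectorExterior o i := by
  intro x hx
  by_contra hn
  simp only [sector, sectorExterior, Set.mem_union, Set.mem_inter_iff, Set.mem_ofPred_eq,
    not_or, not_and_or, not_lt] at hn
  obtain ⟨hA | hB, hA', hB'⟩ := hn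
  · refine h (o 1 - x 1) (by linarith) ?_
    convert hx
    ext j
    fin_cases j <;> simp
    linarith
  · refine h' (o 1 - x 1) (by linarith) ?_
    convert hx
    ext j
    fin_cases j <;> simp
    linarith

theorem exists_many_unboundedFaces {n k : ℕ} (hk : k < n) :
    ∃ (S : Fin n → LineSeg) (H : Finset (Fin n)), PairwiseDisjoint S ∧ GeneralPosition S ∧
      H.card = k ∧ (k : ℕ∞) ≤ (unboundedFaces (region S H)).encard := by
  obtain ⟨S, hd, hg, hgood, hbad⟩ := exists_generalPosition (by omega : 0 < n)
    (pairwiseDisjoint_fan n k) eventually_fan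
  refine ⟨S, initial n k, hd, hg, card_initial hk, ?_⟩
  have hκ : (⟨k, hk⟩ : Fin n) ∉ initial n k := by simp
  set o := ends S (⟨k, hk⟩, false)
  have hnot : ∀ i < k, ∀ r ≥ 0, ray o (3 * i) (-1) r ∉ region S (initial n k) := fun i hi r hr =>
    ray_notMem_region (i := ⟨i, hi.trans hk⟩) (by simpa using hi) hκ hr
      (hbad ⟨i, hi.trans hk⟩ (by simpa using hi) _ hκ)
  have hev : ∀ᶠ R in atTop, ∀ i : Fin k,
      ray o (fanDir k i).1 (fanDir k i).2 R ∈ region S (initial n k) ∧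
      connectedComponentIn (region S (initial n k)) (ray o (fanDir k i).1 (fanDir k i).2 R) ∈
        unboundedFaces (region S (initial n k)) := by
    refine eventually_all.2 fun i => ?_
    have := eventually_ray_mem_region o (hgood ⟨i, i.2.trans hk⟩)
    exact this.and (eventually_component_ray_mem_unboundedFaces (fanDir_ne k i) this)
  obtain ⟨R, hR, hR0⟩ := (hev.and (eventually_gt_atTop 0)).exists
  refine natCast_le_encard (fun i : Fin k => connectedComponentIn (region S (initial n k))
    (ray o (fanDir k i).1 (fanDir k i).2 R)) ?_ fun i => (hR i).2
  -- For `i < j` the sector between the blocked rays `i` and `i + 1` contains the sample point `i`,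
  -- and its exterior contains the sample point `j`. The last sample point, in direction `(0, 1)`,
  -- lies outside all the sectors.
  refine injective_of_lt_imp_ne fun i j hij => ?_
  have hij' : i.val + 1 ≤ j.val := hij
  have hik : i.val + 1 < k := hij'.trans_lt j.2
  refine connectedComponentIn_ne (isOpen_sector o i) (isOpen_sectorExterior o i)
    (disjoint_sector o i)
    (subset_sector_union (hnot i i.2) (by exact_mod_cast hnot (i + 1) hik)) (hR i).1 ?_ (hR j).1 ?_
  · simp only [fanDir, hik, if_true, sector, Set.mem_inter_iff, Set.mem_ofPred_eq, ray_zero, ray_one]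
    constructor <;> linarith
  · right
    have hi0 : (0 : ℝ) ≤ i.val := Nat.cast_nonneg _
    have hc : (i.val : ℝ) + 1 ≤ j.val := by exact_mod_cast hij'
    have := mul_le_mul_of_nonneg_left hc hR0.le
    rw [Set.mem_ofPred_eq]
    by_cases hjk : j.val + 1 < k <;>
      simp only [fanDir, hjk, if_true, if_false, ray_zero, ray_one]
    · linarith
    · nlinarith

/-! ### The grate: one bounded face between each two neighbouring stubs. -/

/-- A horizontal segment of length `8 * n` at height `y`. -/
noncomputable def rail (n : ℕ) (hn : 0 < n) (y : ℝ) : LineSeg where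
  p := !₂[0, y]
  q := !₂[8 * n, y]
  ne h := by
    have : n = 0 := by simpa using congrArg (fun y : Plane => y 0) h
    omega

lemma mem_rail {n : ℕ} {hn : 0 < n} {y : ℝ} {x : Plane} (h : x ∈ (rail n hn y).carrier) :
    x 1 = y := by
  obtain ⟨u, v, hu, hv, huv, rfl⟩ := h
  simp only [rail, PiLp.add_apply, PiLp.smul_apply, smul_eq_mul, Matrix.cons_val_zero,
    Matrix.cons_val_one]
  rw [← add_mul, huv, one_mul]

lemma mem_rail_of_le {n : ℕ} {hn : 0 < n} {x y : ℝ} (h0 : 0 ≤ x) (h1 : x ≤ 8 * n) :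
    !₂[x, y] ∈ (rail n hn y).carrier := by
  have hn' : (0 : ℝ) < 8 * n := by positivity
  refine ⟨1 - x / (8 * n), x / (8 * n), ?_, by positivity, by ring, ?_⟩
  · rw [sub_nonneg, div_le_one hn']
    exact h1
  · ext i
    fin_cases i <;> simp [rail]
    · field_simp
    · ring

/-- The height of the rail with index `i`. -/
noncomputable def railHeight (n i : ℕ) : ℝ := if i = 0 then -1 else 1 + i / n

lemma railHeight_mem {n i : ℕ} (h : i < n) :
    railHeight n i = -1 ∨ 1 ≤ railHeight n i ∧ railHeight n i ≤ 2 := by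
  have hn : (0 : ℝ) < n := Nat.cast_pos.2 (by omega)
  have h1 : (i : ℝ) / n ≤ 1 := by
    rw [div_le_one hn]
    exact_mod_cast h.le
  have h0 : (0 : ℝ) ≤ i / n := by positivity
  unfold railHeight
  split_ifs
  · exact Or.inl rfl
  · exact Or.inr ⟨by linarith, by linarith⟩

lemma railHeight_ne {n i j : ℕ} (hn : 0 < n) (h : i < j) : railHeight n i ≠ railHeight n j := by
  have hn : (0 : ℝ) < n := Nat.cast_pos.2 hn
  have hj : (0 : ℝ) ≤ j / n := by positivity
  unfold railHeight
  rw [if_neg (by omega : j ≠ 0)]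
  split_ifs
  · linarith
  · have : (i : ℝ) / n < j / n := by
      rw [div_lt_div_iff_of_pos_right hn]
      exact_mod_cast h
    linarith

/-- The family of `k` rails, and of `n - k` stubs between the lowest two. -/
noncomputable def grate (n k : ℕ) (i : Fin n) : LineSeg :=
  if i.val < k then rail n i.pos (railHeight n i) else stub (8 * i.val)

lemma pairwiseDisjoint_grate (n k : ℕ) : PairwiseDisjoint (grate n k) := by
  refine pairwiseDisjoint_of_lt fun i j hij => ?_
  have hij' : i.val < j.val := hij
  by_cases hi : i.val < k <;> by_cases hj : j.val < k
  · simp only [grate, hi, hj, if_true, Set.disjoint_left]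
    exact fun y hy hy' => railHeight_ne i.pos hij' ((mem_rail hy).symm.trans (mem_rail hy'))
  · simp only [grate, hi, hj, if_true, if_false, Set.disjoint_left]
    intro y hy hy'
    obtain ⟨-, h0, h1⟩ := mem_stub hy'
    rw [mem_rail hy] at h0 h1
    rcases railHeight_mem i.2 with h | h <;> linarith
  · omega
  · simp only [grate, hi, hj, if_false]
    refine disjoint_stub fun h => ?_
    have : (i.val : ℝ) = j.val := by linarith
    exact hij'.ne (by exact_mod_cast this)

/-- The properties of the family `grate n k` from which its faces are found. -/
structure IsGrate {n : ℕ} (k : ℕ) (hn : 1 < n) (z : Fin n × Bool → Plane) : Prop where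
  low : ∀ t ∉ initial n k, ∀ c, z (⟨0, by omega⟩, c) 1 + 1 / 2 < z (t, false) 1
  high : ∀ t ∉ initial n k, ∀ c, z (t, false) 1 + 1 / 2 < z (⟨1, hn⟩, c) 1
  stub_left : ∀ t ∉ initial n k, ∀ d, 8 * (t.val : ℝ) - 1 < z (t, d) 0
  stub_right : ∀ t ∉ initial n k, ∀ d, z (t, d) 0 < 8 * (t.val : ℝ) + 1
  left : ∀ s ∈ initial n k, ∀ t ∉ initial n k, ∀ d, z (s, false) 0 < z (t, d) 0
  right : ∀ s ∈ initial n k, ∀ t ∉ initial n k, ∀ d, z (t, d) 0 < z (s, true) 0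
  near : ∀ s ∈ initial n k, ∀ j : Fin n, ∃ y ∈ segment ℝ (z (s, false)) (z (s, true)),
    dist (!₂[8 * (j.val : ℝ) + 4, 0] : Plane) y < 3

lemma eventually_isGrate {n k : ℕ} (hn : 1 < n) (hk : 1 < k) :
    ∀ᶠ z in 𝓝 (ends (grate n k)), IsGrate k hn z := by
  have hn0 : (0 : ℝ) < n := Nat.cast_pos.2 (by omega)
  have lt_of_lt : ∀ f g : (Fin n × Bool → Plane) → ℝ, Continuous f → Continuous g →
      f (ends (grate n k)) < g (ends (grate n k)) → ∀ᶠ z in 𝓝 (ends (grate n k)), f z < g z :=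
    fun f g hf hg h => (hf.tendsto _).eventually_lt (hg.tendsto _) h
  have hA : ∀ᶠ z in 𝓝 (ends (grate n k)), ∀ t ∉ initial n k, ∀ c,
      z (⟨0, by omega⟩, c) 1 + 1 / 2 < z (t, false) 1 := by
    refine eventually_all.2 fun t => eventually_imp_distrib_left.2 fun ht =>
      eventually_all.2 fun c => lt_of_lt _ _ (by fun_prop) (by fun_prop) ?_
    rw [mem_initial] at ht
    cases c <;> simp [grate, ht, rail, stub, (by omega : 0 < k), railHeight] <;> norm_num
  have hB : ∀ᶠ z in 𝓝 (ends (grate n k)), ∀ t ∉ initial n k, ∀ c,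
      z (t, false) 1 + 1 / 2 < z (⟨1, hn⟩, c) 1 := by
    refine eventually_all.2 fun t => eventually_imp_distrib_left.2 fun ht =>
      eventually_all.2 fun c => lt_of_lt _ _ (by fun_prop) (by fun_prop) ?_
    rw [mem_initial] at ht
    have : (0 : ℝ) < (n : ℝ)⁻¹ := by positivity
    cases c <;> simp [grate, ht, rail, stub, hk, railHeight] <;> linarith
  have hC : ∀ᶠ z in 𝓝 (ends (grate n k)), ∀ t ∉ initial n k, ∀ d,
      8 * (t.val : ℝ) - 1 < z (t, d) 0 := by
    refine eventually_all.2 fun t => eventually_imp_distrib_left.2 fun ht =>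
      eventually_all.2 fun d => lt_of_lt _ _ (by fun_prop) (by fun_prop) ?_
    rw [mem_initial] at ht
    cases d <;> simp [grate, ht, stub]
  have hD : ∀ᶠ z in 𝓝 (ends (grate n k)), ∀ t ∉ initial n k, ∀ d,
      z (t, d) 0 < 8 * (t.val : ℝ) + 1 := by
    refine eventually_all.2 fun t => eventually_imp_distrib_left.2 fun ht =>
      eventually_all.2 fun d => lt_of_lt _ _ (by fun_prop) (by fun_prop) ?_
    rw [mem_initial] at ht
    cases d <;> simp [grate, ht, stub]
  have hE : ∀ᶠ z in 𝓝 (ends (grate n k)), ∀ s ∈ initial n k, ∀ t ∉ initial n k, ∀ d,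
      z (s, false) 0 < z (t, d) 0 := by
    refine eventually_all.2 fun s => eventually_imp_distrib_left.2 fun hs =>
      eventually_all.2 fun t => eventually_imp_distrib_left.2 fun ht =>
      eventually_all.2 fun d => lt_of_lt _ _ (by fun_prop) (by fun_prop) ?_
    rw [mem_initial] at hs ht
    have : 0 < t.val := by omega
    cases d <;> simp [grate, hs, ht, stub, rail, this]
  have hF : ∀ᶠ z in 𝓝 (ends (grate n k)), ∀ s ∈ initial n k, ∀ t ∉ initial n k, ∀ d,
      z (t, d) 0 < z (s, true) 0 := by
    refine eventually_all.2 fun s => eventually_imp_distrib_left.2 fun hs =>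
      eventually_all.2 fun t => eventually_imp_distrib_left.2 fun ht =>
      eventually_all.2 fun d => lt_of_lt _ _ (by fun_prop) (by fun_prop) ?_
    rw [mem_initial] at hs ht
    cases d <;> simp [grate, hs, ht, stub, rail]
  have hG : ∀ᶠ z in 𝓝 (ends (grate n k)), ∀ s ∈ initial n k, ∀ j : Fin n,
      ∃ y ∈ segment ℝ (z (s, false)) (z (s, true)),
        dist (!₂[8 * (j.val : ℝ) + 4, 0] : Plane) y < 3 := by
    refine eventually_all.2 fun s => eventually_imp_distrib_left.2 fun hs =>
      eventually_all.2 fun j => ?_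
    rw [mem_initial] at hs
    have hj : (j.val : ℝ) + 1 ≤ n := by exact_mod_cast j.2
    have hmem : !₂[8 * (j.val : ℝ) + 4, railHeight n s] ∈ (grate n k s).carrier := by
      simp only [grate, hs, if_true]
      exact mem_rail_of_le (by positivity) (by linarith)
    -- The point above or below the midpoint is at distance at most 2. Its barycentric coordinates
    -- stay fixed, so it moves continuously with the endpoints and stays within distance 3.
    obtain ⟨u, v, hu, hv, huv, huv'⟩ := hmem
    have hlt := lt_of_lt (fun z => dist (!₂[8 * (j.val : ℝ) + 4, 0] : Plane)
      (u • z (s, false) + v • z (s, true))) (fun _ => 3) (by fun_prop) (by fun_prop) (by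
        simp only [ends_false, ends_true, huv']
        rw [← sq_lt_sq₀ dist_nonneg (by norm_num), dist_sq_eq]
        simp only [Matrix.cons_val_zero, Matrix.cons_val_one]
        rcases railHeight_mem s.2 with h | h
        · rw [h]; norm_num
        · nlinarith)
    exact hlt.mono fun z hz => ⟨_, ⟨u, v, hu, hv, huv, rfl⟩, hz⟩
  filter_upwards [hA, hB, hC, hD, hE, hF, hG] with z h1 h2 h3 h4 h5 h6 h7
  exact ⟨h1, h2, h3, h4, h5, h6, h7⟩

lemma isOpen_left (a : ℝ) : IsOpen {x : Plane | x 0 < a} := isOpen_lt (by fun_prop) (by fun_prop)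

lemma isOpen_right (a : ℝ) : IsOpen {x : Plane | a < x 0} := isOpen_lt (by fun_prop) (by fun_prop)

lemma disjoint_left_right (a : ℝ) : Disjoint {x : Plane | x 0 < a} {x : Plane | a < x 0} := by
  rw [Set.disjoint_left]
  exact fun x hx hx' => lt_asymm (Set.mem_ofPred.1 hx) (Set.mem_ofPred.1 hx')

/-- A point nearer to `s` than to `t` cannot be far above a point `o` of `t` if `s` lies below that
point; `σ` is the sign of the direction. -/
lemma height_le {s t : LineSeg} {o x : Plane} {σ W : ℝ} (hσ : σ ^ 2 = 1) (ho : o ∈ t.carrier)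
    (hp : σ * s.p 1 + 1 / 2 < σ * o 1) (hq : σ * s.q 1 + 1 / 2 < σ * o 1)
    (hx : s.dist x < t.dist x) (hW : |x 0 - o 0| ≤ W) : σ * (x 1 - o 1) ≤ W ^ 2 := by
  obtain ⟨y, hy, hsy⟩ := s.exists_dist_eq x
  have hyo := LineSeg.lin_lt (s := s) (a := 0) (b := σ) (M := σ * o 1 - 1 / 2) (by linarith)
    (by linarith) hy
  have hd : dist x y < dist x o := hsy ▸ hx.trans_le (LineSeg.dist_le ho)
  rw [← sq_lt_sq₀ dist_nonneg dist_nonneg, dist_sq_eq, dist_sq_eq] at hd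
  have hW2 : (x 0 - o 0) ^ 2 ≤ W ^ 2 := sq_le_sq' (abs_le.1 hW).1 (abs_le.1 hW).2
  by_contra! hlt
  have h1 : (σ * (x 1 - y 1)) ^ 2 = (x 1 - y 1) ^ 2 := by rw [mul_pow, hσ, one_mul]
  have h2 : (σ * (x 1 - o 1)) ^ 2 = (x 1 - o 1) ^ 2 := by rw [mul_pow, hσ, one_mul]
  have h3 : σ * (x 1 - o 1) + 1 / 2 ≤ σ * (x 1 - y 1) := by linarith
  -- If the height `h = σ * (x 1 - o 1)` exceeds `W ^ 2`, then `(h + 1 / 2) ^ 2 < W ^ 2 + h ^ 2`,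
  -- which forces `h < W ^ 2`.
  have h4 := pow_le_pow_left₀ (by nlinarith [sq_nonneg W]) h3 2
  nlinarith [sq_nonneg (x 0 - y 0)]

namespace IsGrate

variable {n k : ℕ} {hn : 1 < n} {S : Fin n → LineSeg}

/-- The vertical line through the base of a stub is blocked: upwards by comparison with rail 0,
which lies below the base, and downwards by comparison with rail 1, which lies above it. -/
lemma region_subset (h : IsGrate k hn (ends S)) (hk : 1 < k) {t : Fin n} (ht : t ∉ initial n k) :
    region S (initial n k) ⊆ {x | x 0 < (S t).p 0} ∪ {x | (S t).p 0 < x 0} := by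
  intro x hx
  by_contra hne
  simp only [Set.mem_union, Set.mem_ofPred_eq, not_or, not_lt] at hne
  have h0 : x 0 = (S t).p 0 := le_antisymm hne.2 hne.1
  rcases le_total ((S t).p 1) (x 1) with hle | hle
  · refine ray_notMem_region (a := 0) (b := 1) (r := x 1 - (S t).p 1) (i := ⟨0, by omega⟩)
      (mem_initial.2 (by change 0 < k; omega)) ht (by linarith)
      (fun c => by linarith [h.low t ht c]) ?_
    convert hx
    ext i
    fin_cases i <;> simp [h0]
  · refine ray_notMem_region (a := 0) (b := -1) (r := (S t).p 1 - x 1) (i := ⟨1, hn⟩)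
      (mem_initial.2 hk) ht (by linarith) (fun c => by linarith [h.high t ht c]) ?_
    convert hx
    ext i
    fin_cases i <;> simp [h0]

/-- Every rail passes within distance 3. Stubs stay within 1 of the abscissas `8 * t`, so they are
at least 3 away from abscissa `8 * j + 4`. -/
lemma midpoint_mem (h : IsGrate k hn (ends S)) (j : Fin n) :
    !₂[8 * (j.val : ℝ) + 4, 0] ∈ region S (initial n k) := by
  intro s hs t ht
  obtain ⟨y, hy, hlt⟩ := h.near s hs j
  refine ((LineSeg.dist_le (s := S s) hy).trans_lt hlt).trans_le ?_
  obtain ⟨w, hw, htw⟩ := (S t).exists_dist_eq !₂[8 * (j.val : ℝ) + 4, 0]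
  rw [htw, ← sq_le_sq₀ (by norm_num) dist_nonneg, dist_sq_eq]
  simp only [Matrix.cons_val_zero, Matrix.cons_val_one]
  have h1 := LineSeg.lin_lt (s := S t) (a := 1) (b := 0) (M := 8 * t.val + 1)
    (by linarith [show (S t).p 0 < 8 * (t.val : ℝ) + 1 from h.stub_right t ht false])
    (by linarith [show (S t).q 0 < 8 * (t.val : ℝ) + 1 from h.stub_right t ht true]) hw
  have h2 := LineSeg.lin_lt (s := S t) (a := -1) (b := 0) (M := -(8 * t.val - 1))
    (by linarith [show 8 * (t.val : ℝ) - 1 < (S t).p 0 from h.stub_left t ht false])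
    (by linarith [show 8 * (t.val : ℝ) - 1 < (S t).q 0 from h.stub_left t ht true]) hw
  rcases le_or_gt t.val j.val with htj | htj
  · have : (t.val : ℝ) ≤ j.val := by exact_mod_cast htj
    nlinarith [sq_nonneg (0 - w 1)]
  · have : (j.val : ℝ) + 1 ≤ t.val := by exact_mod_cast htj
    nlinarith [sq_nonneg (0 - w 1)]

/-- Near the vertical line through the stub, `height_le` bounds the region above by comparison with
rail 0 and below by comparison with rail 1. -/
lemma isBounded_strip (h : IsGrate k hn (ends S)) (hk : 1 < k) {t : Fin n} (ht : t ∉ initial n k)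
    (W : ℝ) : Bornology.IsBounded {x ∈ region S (initial n k) | |x 0 - (S t).p 0| ≤ W} := by
  refine (Metric.isBounded_closedBall (x := (S t).p) (r := W + W ^ 2)).subset ?_
  rintro x ⟨hx, hW⟩
  have h0 : 0 < n := by omega
  have hW0 : 0 ≤ W := (abs_nonneg _).trans hW
  have h1 := height_le (σ := 1) (by norm_num) (S t).p_mem
    (by linarith [show (S ⟨0, h0⟩).p 1 + 1 / 2 < (S t).p 1 from h.low t ht false])
    (by linarith [show (S ⟨0, h0⟩).q 1 + 1 / 2 < (S t).p 1 from h.low t ht true])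
    (hx ⟨0, h0⟩ (mem_initial.2 (by change 0 < k; omega)) t ht) hW
  have h2 := height_le (σ := -1) (by norm_num) (S t).p_mem
    (by linarith [show (S t).p 1 + 1 / 2 < (S ⟨1, hn⟩).p 1 from h.high t ht false])
    (by linarith [show (S t).p 1 + 1 / 2 < (S ⟨1, hn⟩).q 1 from h.high t ht true])
    (hx ⟨1, hn⟩ (mem_initial.2 hk) t ht) hW
  rw [Metric.mem_closedBall, ← sq_le_sq₀ dist_nonneg (by positivity), dist_sq_eq]
  have h3 : (x 0 - (S t).p 0) ^ 2 ≤ W ^ 2 := sq_le_sq' (abs_le.1 hW).1 (abs_le.1 hW).2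
  have h4 : (x 1 - (S t).p 1) ^ 2 ≤ (W ^ 2) ^ 2 := sq_le_sq' (by linarith) (by linarith)
  have : 0 ≤ W * W ^ 2 := by positivity
  linarith [add_sq W (W ^ 2)]

lemma le_boundedFaces (h : IsGrate k hn (ends S)) (hk : 1 < k) :
    ((n - k - 1 : ℕ) : ℕ∞) ≤ (boundedFaces (region S (initial n k))).encard := by
  refine natCast_le_encard (fun j : Fin (n - k - 1) => connectedComponentIn
    (region S (initial n k)) !₂[8 * ((k + j.val : ℕ) : ℝ) + 4, 0]) ?_ ?_
  · refine injective_of_lt_imp_ne fun i j hij => ?_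
    have hij' : k + i.val + 1 ≤ k + j.val := by have : i.val < j.val := hij; omega
    have hc : ((k + i.val : ℕ) : ℝ) + 1 ≤ (k + j.val : ℕ) := by exact_mod_cast hij'
    have hj : k + j.val < n := by omega
    have ht : (⟨k + j, hj⟩ : Fin n) ∉ initial n k := by simp
    refine connectedComponentIn_ne (isOpen_left _) (isOpen_right _) (disjoint_left_right _)
      (h.region_subset hk ht) (h.midpoint_mem ⟨k + i, by omega⟩) ?_
      (h.midpoint_mem ⟨k + j, hj⟩) ?_
    · have := h.stub_left _ ht false
      simp only [ends_false] at this
      simp only [Set.mem_ofPred_eq, Matrix.cons_val_zero]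
      linarith
    · have := h.stub_right _ ht false
      simp only [ends_false] at this
      simp only [Set.mem_ofPred_eq, Matrix.cons_val_zero]
      linarith
  · intro j
    have hj : k + j.val + 1 < n := by omega
    have ht : (⟨k + j, by omega⟩ : Fin n) ∉ initial n k := by simp
    have ht' : (⟨k + j + 1, hj⟩ : Fin n) ∉ initial n k := by simp; omega
    have hm := h.midpoint_mem ⟨k + j, by omega⟩
    refine ⟨⟨_, hm, rfl⟩, (h.isBounded_strip hk ht 10).subset fun x hx => ?_⟩
    have h1 := h.stub_right _ ht false
    have h1' := h.stub_left _ ht false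
    have h2 := h.stub_left _ ht' false
    have h2' := h.stub_right _ ht' false
    simp only [ends_false] at h1 h1' h2 h2'
    push_cast at h1 h1' h2 h2'
    have h3 := connectedComponentIn_subset_left (isOpen_right _) (isOpen_left _)
      (disjoint_left_right _).symm ((h.region_subset hk ht).trans (Set.union_comm _ _).le) hm
      (by simp only [Set.mem_ofPred_eq, Matrix.cons_val_zero]; push_cast; linarith) hx
    have h4 := connectedComponentIn_subset_left (isOpen_left _) (isOpen_right _)
      (disjoint_left_right _) (h.region_subset hk ht') hm
      (by simp only [Set.mem_ofPred_eq, Matrix.cons_val_zero]; push_cast; linarith) hx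
    rw [Set.mem_ofPred_eq] at h3 h4
    exact ⟨connectedComponentIn_subset _ _ hx, abs_le.2 ⟨by linarith, by linarith⟩⟩

/-- All rails reach farther left and farther right than all stubs, so both horizontal rays end in
the region; the vertical line through stub `k` separates them. -/
lemma two_le_unboundedFaces (h : IsGrate k hn (ends S)) (hk : 1 < k) (hkn : k < n) :
    (2 : ℕ∞) ≤ (unboundedFaces (region S (initial n k))).encard := by
  have ht : (⟨k, hkn⟩ : Fin n) ∉ initial n k := by simp
  set o := (S ⟨k, hkn⟩).p with ho
  have hl := eventually_ray_mem_region (S := S) (H := initial n k) (a := -1) (b := 0) o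
    fun s hs t ht => ⟨false, fun d => by linarith [h.left s hs t ht d]⟩
  have hr := eventually_ray_mem_region (S := S) (H := initial n k) (a := 1) (b := 0) o
    fun s hs t ht => ⟨true, fun d => by linarith [h.right s hs t ht d]⟩
  obtain ⟨R, ⟨⟨hl, hr⟩, hlu, hru⟩, hR⟩ := (((hl.and hr).and
    ((eventually_component_ray_mem_unboundedFaces (by norm_num) hl).and
    (eventually_component_ray_mem_unboundedFaces (by norm_num) hr))).and
    (eventually_gt_atTop 0)).exists
  rw [← Set.encard_pair (connectedComponentIn_ne (isOpen_left _) (isOpen_right _)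
    (disjoint_left_right _) (h.region_subset hk ht) hl (by simpa [← ho] using hR) hr
    (by simpa [← ho] using hR))]
  exact Set.encard_le_encard (Set.pair_subset hlu hru)

end IsGrate

theorem exists_many_boundedFaces {n k : ℕ} (hk : 1 < k) (hkn : k < n) :
    ∃ (S : Fin n → LineSeg) (H : Finset (Fin n)), PairwiseDisjoint S ∧ GeneralPosition S ∧
      H.card = k ∧ ((n - k - 1 : ℕ) : ℕ∞) ≤ (boundedFaces (region S H)).encard ∧
      (2 : ℕ∞) ≤ (unboundedFaces (region S H)).encard := by
  obtain ⟨S, hd, hg, hS⟩ := exists_generalPosition (by omega : 0 < n)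
    (pairwiseDisjoint_grate n k) (eventually_isGrate (hk.trans hkn) hk)
  exact ⟨S, initial n k, hd, hg, card_initial hkn, hS.le_boundedFaces hk,
    hS.two_le_unboundedFaces hk hkn⟩

/-! ### Combining the two constructions. -/

lemma encard_boundedFaces_add_encard_unboundedFaces_le (V : Set Plane) :
    (boundedFaces V).encard + (unboundedFaces V).encard ≤ (faces V).encard := by
  rw [← Set.encard_union_eq]
  · exact Set.encard_le_encard (Set.union_subset (fun _ h => h.1) fun _ h => h.1)
  · exact Set.disjoint_left.2 fun _ h h' => h'.2 h.2

end SegVoronoi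

theorem mainTheorem8 :
    -- a region with a linear number of faces, uniformly for `1 < k < n`
    (∃ c : ℝ, 0 < c ∧ ∀ n k : ℕ, 1 < k → k < n →
      ∃ (S : Fin n → SegVoronoi.LineSeg) (H : Finset (Fin n)),
        SegVoronoi.PairwiseDisjoint S ∧ SegVoronoi.GeneralPosition S ∧ H.card = k ∧
        ∃ m : ℕ, c * (n : ℝ) ≤ (m : ℝ) ∧
          (m : ℕ∞) ≤ (SegVoronoi.faces (SegVoronoi.region S H)).encard) ∧
    -- `n - k + 1` faces, of which `n - k - 1` bounded (linear in `n` for small `k`)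
    (∀ n k : ℕ, 1 < k → k < n →
      ∃ (S : Fin n → SegVoronoi.LineSeg) (H : Finset (Fin n)),
        SegVoronoi.PairwiseDisjoint S ∧ SegVoronoi.GeneralPosition S ∧ H.card = k ∧
        ((n - k - 1 : ℕ) : ℕ∞) ≤ (SegVoronoi.boundedFaces (SegVoronoi.region S H)).encard ∧
        (2 : ℕ∞) ≤ (SegVoronoi.unboundedFaces (SegVoronoi.region S H)).encard) ∧
    -- `k` unbounded faces (linear in `n` for large `k`)
    (∀ n k : ℕ, 1 < k → k < n →
      ∃ (S : Fin n → SegVoronoi.LineSeg) (H : Finset (Fin n)),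
        SegVoronoi.PairwiseDisjoint S ∧ SegVoronoi.GeneralPosition S ∧ H.card = k ∧
        (k : ℕ∞) ≤ (SegVoronoi.unboundedFaces (SegVoronoi.region S H)).encard) := by
  refine ⟨⟨1 / 2, by norm_num, fun n k hk hkn => ?_⟩,
    fun n k hk hkn => SegVoronoi.exists_many_boundedFaces hk hkn,
    fun n k _ hkn => SegVoronoi.exists_many_unboundedFaces hkn⟩
  -- The fan gives `k ≥ n / 2` faces in the first case; in the second the grate gives `n - k + 1 > n
  -- / 2`, counting bounded and unbounded faces together.
  by_cases hnk : n ≤ 2 * k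
  · obtain ⟨S, H, hd, hg, hH, hf⟩ := SegVoronoi.exists_many_unboundedFaces hkn
    refine ⟨S, H, hd, hg, hH, k, ?_, hf.trans (Set.encard_le_encard fun _ h => h.1)⟩
    have : (n : ℝ) ≤ 2 * k := by exact_mod_cast hnk
    linarith
  · obtain ⟨S, H, hd, hg, hH, hb, hu⟩ := SegVoronoi.exists_many_boundedFaces hk hkn
    refine ⟨S, H, hd, hg, hH, n - k - 1 + 2, ?_, ?_⟩
    · have : (n : ℝ) ≤ 2 * ((n - k - 1 + 2 : ℕ) : ℝ) := by
        exact_mod_cast (by omega : n ≤ 2 * (n - k - 1 + 2))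
      linarith
    · push_cast
      exact (add_le_add hb hu).trans
        (SegVoronoi.encard_boundedFaces_add_encard_unboundedFaces_le _)
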